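/- Let $\eta \ge 0$, $0<\alpha<1$, $L,U\in\mathbb{R}^\eta$ with $L\le U$, $D=[L,U]=\{x\in\mathbb{R}^\eta : L_i\le x_i\le U_i \ \forall i\}$, and $f(x)=w\cdot x+b$ with $w\in\mathbb{R}^\eta$, $b\in\mathbb{R}$. Write $\mathrm{Leaky}(v)=\max\{\alpha v,v\}$, $\operatorname{gr}(\mathrm{Leaky}\circ f;D)=\{(x,y)\in\mathbb{R}^\eta\times\mathbb{R} : x\in D,\ y=\mathrm{Leaky}(f(x))\}$, $M^+=\max_{x\in D}f(x)$, $M^-=\min_{x\in D}f(x)$; let $\breve L_i=L_i,\ \breve U_i=U_i$ if $w_i\ge 0$ and $\breve L_i=U_i,\ \breve U_i=L_i$ if $w_i<0$. A finite system of linear inequalities in $(x,y,z)\in\mathbb{R}^\eta\times\mathbb{R}\times\mathbb{R}$ with solution set $Q$, together with $z\in\{0,1\}$, is a valid formulation of $S\subseteq\mathbb{R}^{\eta+1}$ if $S$ is the projection to $(x,y)$ of $\underline{Q}=\{(x,y,z)\in Q : z\in\{0,1\}\}$. It is ideal if moreover every extreme point of $Q$ has $z\in\{0,1\}$. An inequality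 is facet-defining for it if it holds on $\underline{Q}$ and the set of points of $\underline{Q}$ satisfying it with equality has dimension $\dim\underline{Q}-1$ (dimension of the affine hull, with $\dim\emptyset=-1$). (a) The system $$y\ge f(x)\quad(1),\qquad y\ge\alpha f(x)\quad(2),$$ $$y\le f(x)-(1-\alpha)M^-(1-z)\quad(3),\qquad y\le\alpha f(x)-(\alpha-1)M^+z\quad(4),$$ $$(x,y,z)\in[L,U]\times\mathbb{R}\times[0,1],\qquad z\in\{0,1\}$$ is a valid formulation of $\operatorname{gr}(\mathrm{Leaky}\circ f;D)$. (b) Adding to this system the inequalities $$y\le\Big(\sum_{i\in I}w_i(x_i-\breve L_i(1-z))+\Big(b+\sum_{i\notin I}w_i\breve U_i\Big)z\Big)+\alpha\Big(\sum_{i\notin I}w_i(x_i-\breve U_iz)+\Big(b+\sum_{i\in I}w_i\breve L_i\Big)(1-z)\Big)\quad(5_I)$$ for all $I\subseteq\{1,\dots,\eta\}$ gives an ideal formulation of $\operatorname{gr}(\mathrm{Leaky}\circ f;D)$. (c) If the neuron is irreducible, i.e. $f(x)>\alpha f(x)$ for some $x\in D$ and $\alpha f(x')>f(x')$ for some $x'\in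 D$, then each of the inequalities (1)--(4) and $(5_I)$, $I\subseteq\{1,\dots,\eta\}$, is facet-defining, both for the formulation in (a) and for the formulation in (b). (d) The family $(5_I)$ can be separated in $\mathcal{O}(\eta)$ time: there are a single unit-cost real RAM program (elementary steps: real addition, subtraction, multiplication, comparison, rational constants, array access and index increment) and a constant $C$ such that for all $\eta$, all data $\alpha,w,b,L,U$ as above and every point $(\hat x,\hat y,\hat z)\in\mathbb{R}^\eta\times\mathbb{R}\times\mathbb{R}$, the program halts after at most $C(\eta+1)$ steps and returns the coefficients of a most violated inequality of the family $(5_I)$ at $(\hat x,\hat y,\hat z)$ if some inequality of the family is violated there, and otherwise reports that none is. -/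

import Mathlib

noncomputable section

namespace LeakyReLU

/-! ### Graphs, big-M coefficients, irreducibility -/

/-- The leaky ReLU activation function. -/
def leaky (α v : ℝ) : ℝ := max (α * v) v

/-- The affine function with weights `w` and bias `b`. -/
def affine {η : ℕ} (w : Fin η → ℝ) (b : ℝ) (x : Fin η → ℝ) : ℝ := (∑ i, w i * x i) + b

/-- The graph of `g` over the domain `D`. -/
def graph {η : ℕ} (g : (Fin η → ℝ) → ℝ) (D : Set (Fin η → ℝ)) : Set ((Fin η → ℝ) × ℝ) :=
  {p | p.1 ∈ D ∧ p.2 = g p.1}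

/-- The maximum of `g` over `D` (for a continuous `g` and a nonempty compact `D`). -/
def Mplus {η : ℕ} (g : (Fin η → ℝ) → ℝ) (D : Set (Fin η → ℝ)) : ℝ := sSup (g '' D)

/-- The minimum of `g` over `D` (for a continuous `g` and a nonempty compact `D`). -/
def Mminus {η : ℕ} (g : (Fin η → ℝ) → ℝ) (D : Set (Fin η → ℝ)) : ℝ := sInf (g '' D)

/-- The neuron "maximum of `g 0, …, g (d - 1)` over `D`" is irreducible: each of the pieces is
somewhere on `D` strictly larger than all the others. -/
def IrreducibleNeuron {η d : ℕ} (g : Fin d → (Fin η → ℝ) → ℝ) (D : Set (Fin η → ℝ)) : Prop :=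
  ∀ k, ∃ x ∈ D, ∀ l, l ≠ k → g l x < g k x

theorem Mplus_isGreatest {η : ℕ} (w : Fin η → ℝ) (b : ℝ) {L U : Fin η → ℝ} (h : L ≤ U) :
    IsGreatest (affine w b '' Set.Icc L U) (Mplus (affine w b) (Set.Icc L U)) := by
  have hc : IsCompact (affine w b '' Set.Icc L U) := by
    refine isCompact_Icc.image ?_
    unfold affine
    fun_prop
  exact hc.isGreatest_sSup ((Set.nonempty_Icc.2 h).image _)

theorem Mminus_isLeast {η : ℕ} (w : Fin η → ℝ) (b : ℝ) {L U : Fin η → ℝ} (h : L ≤ U) :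
    IsLeast (affine w b '' Set.Icc L U) (Mminus (affine w b) (Set.Icc L U)) := by
  have hc : IsCompact (affine w b '' Set.Icc L U) := by
    refine isCompact_Icc.image ?_
    unfold affine
    fun_prop
  exact hc.isLeast_sInf ((Set.nonempty_Icc.2 h).image _)

/-! ### Linear inequalities and MIP formulations with one binary variable -/

/-- A point `(x, y, z)`: inputs `x`, output `y`, and one (relaxed) binary variable `z`. -/
abbrev Point (η : ℕ) : Type := (Fin η → ℝ) × ℝ × ℝ

/-- The linear inequality `∑ i, cx i * x i + cy * y + cz * z ≤ rhs`. -/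
structure LinIneq (η : ℕ) where
  cx : Fin η → ℝ
  cy : ℝ
  cz : ℝ
  rhs : ℝ

/-- The amount by which the inequality is violated at `p` (nonpositive when it is satisfied). -/
def LinIneq.violation {η : ℕ} (c : LinIneq η) (p : Point η) : ℝ :=
  (∑ i, c.cx i * p.1 i) + c.cy * p.2.1 + c.cz * p.2.2 - c.rhs

/-- The inequality is satisfied at `p`. -/
def LinIneq.Holds {η : ℕ} (c : LinIneq η) (p : Point η) : Prop := c.violation p ≤ 0

/-- The inequality is satisfied with equality at `p`. -/
def LinIneq.Tight {η : ℕ} (c : LinIneq η) (p : Point η) : Prop := c.violation p = 0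

/-- The LP relaxation: all points that satisfy the system `S` of linear inequalities. -/
def relaxation {η : ℕ} (S : Set (LinIneq η)) : Set (Point η) := {p | ∀ c ∈ S, c.Holds p}

/-- The integer feasible points of the formulation given by `S` and `z ∈ {0, 1}`. -/
def integerPoints {η : ℕ} (S : Set (LinIneq η)) : Set (Point η) :=
  {p | p ∈ relaxation S ∧ (p.2.2 = 0 ∨ p.2.2 = 1)}

/-- The finite system `S`, with the integrality constraint `z ∈ {0, 1}`, is a (valid) MIP
formulation of `T`: the projection of its integer feasible points to `(x, y)` is `T`. -/
def IsFormulation {η : ℕ} (S : Set (LinIneq η)) (T : Set ((Fin η → ℝ) × ℝ)) : Prop :=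
  S.Finite ∧ T = (fun p : Point η => (p.1, p.2.1)) '' integerPoints S

/-- An ideal formulation: a MIP formulation such that `z` is binary at each extreme point of the
LP relaxation. -/
def IsIdealFormulation {η : ℕ} (S : Set (LinIneq η)) (T : Set ((Fin η → ℝ) × ℝ)) : Prop :=
  IsFormulation S T ∧
    ∀ p ∈ Set.extremePoints ℝ (relaxation S), p.2.2 = 0 ∨ p.2.2 = 1

open Classical in
/-- The dimension of a set of points: that of its affine hull, and `-1` for the empty set. -/
def setDim {η : ℕ} (A : Set (Point η)) : ℤ :=
  if A.Nonempty then (Module.finrank ℝ (vectorSpan ℝ A) : ℤ) else -1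

/-- The inequality `c` is valid for the formulation: all integer feasible points satisfy it. -/
def IsValidIneq {η : ℕ} (S : Set (LinIneq η)) (c : LinIneq η) : Prop :=
  ∀ p ∈ integerPoints S, c.Holds p

/-- The inequality `c` is facet-defining for the formulation. -/
def IsFacetDefining {η : ℕ} (S : Set (LinIneq η)) (c : LinIneq η) : Prop :=
  IsValidIneq S c ∧
    setDim {p | p ∈ integerPoints S ∧ c.Tight p} = setDim (integerPoints S) - 1

/-! ### The inequalities for the leaky ReLU

Each of them is given by its coefficients and followed by its usual form. -/

section Inequalities

variable {η : ℕ} (α : ℝ) (w : Fin η → ℝ) (b : ℝ) (L U : Fin η → ℝ)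

/-- The end of the `i`-th interval at which `w i * x i` is smallest. -/
def breveL (i : Fin η) : ℝ := if 0 ≤ w i then L i else U i

/-- The end of the `i`-th interval at which `w i * x i` is largest. -/
def breveU (i : Fin η) : ℝ := if 0 ≤ w i then U i else L i

/-- `y ≥ f x` -/
def lower1 : LinIneq η := ⟨w, -1, 0, -b⟩

/-- `y ≥ α * f x` -/
def lower2 : LinIneq η := ⟨fun i => α * w i, -1, 0, -(α * b)⟩

/-- `y ≤ f x - (1 - α) * M⁻ * (1 - z)` -/
def upper1 : LinIneq η :=
  ⟨fun i => -w i, 1, -((1 - α) * Mminus (affine w b) (Set.Icc L U)),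
    b - (1 - α) * Mminus (affine w b) (Set.Icc L U)⟩

/-- `y ≤ α * f x - (α - 1) * M⁺ * z` -/
def upper2 : LinIneq η :=
  ⟨fun i => -(α * w i), 1, (α - 1) * Mplus (affine w b) (Set.Icc L U), α * b⟩

/-- `L i ≤ x i` -/
def boxLower (i : Fin η) : LinIneq η := ⟨fun j => if j = i then -1 else 0, 0, 0, -L i⟩

/-- `x i ≤ U i` -/
def boxUpper (i : Fin η) : LinIneq η := ⟨fun j => if j = i then 1 else 0, 0, 0, U i⟩

/-- `0 ≤ z` -/
def zLower : LinIneq η := ⟨0, 0, -1, 0⟩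

/-- `z ≤ 1` -/
def zUpper : LinIneq η := ⟨0, 0, 1, 1⟩

/-- The inequality of the exponential family that belongs to `I`. -/
def cut (I : Finset (Fin η)) : LinIneq η :=
  ⟨fun i => if i ∈ I then -w i else -(α * w i), 1,
    -((∑ i ∈ I, w i * breveL w L U i) + (b + ∑ i ∈ Iᶜ, w i * breveU w L U i)
      - α * (∑ i ∈ Iᶜ, w i * breveU w L U i) - α * (b + ∑ i ∈ I, w i * breveL w L U i)),
    α * (b + ∑ i ∈ I, w i * breveL w L U i) - ∑ i ∈ I, w i * breveL w L U i⟩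

/-- The four inequalities that link `y` with `f x` and `z`. -/
def bigMCore : Set (LinIneq η) :=
  {lower1 w b, lower2 α w b, upper1 α w b L U, upper2 α w b L U}

/-- The big-M system, without the integrality constraint. -/
def bigM : Set (LinIneq η) :=
  bigMCore α w b L U ∪
    (Set.range (boxLower L) ∪ Set.range (boxUpper U) ∪ {zLower, zUpper})

/-- The exponential family. -/
def cuts : Set (LinIneq η) := Set.range (cut α w b L U)

variable {α w b L U}

theorem lower1_holds {x : Fin η → ℝ} {y z : ℝ} :
    (lower1 w b).Holds (x, y, z) ↔ y ≥ affine w b x := by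
  simp only [LinIneq.Holds, LinIneq.violation, lower1, affine]
  constructor <;> intro h <;> linarith

theorem lower2_holds {x : Fin η → ℝ} {y z : ℝ} :
    (lower2 α w b).Holds (x, y, z) ↔ y ≥ α * affine w b x := by
  simp only [LinIneq.Holds, LinIneq.violation, lower2, affine, mul_assoc, ← Finset.mul_sum]
  constructor <;> intro h <;> linarith

theorem upper1_holds {x : Fin η → ℝ} {y z : ℝ} :
    (upper1 α w b L U).Holds (x, y, z) ↔
      y ≤ affine w b x - (1 - α) * Mminus (affine w b) (Set.Icc L U) * (1 - z) := by
  simp only [LinIneq.Holds, LinIneq.violation, upper1]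
  simp only [neg_mul, Finset.sum_neg_distrib]
  have h : affine w b x = (∑ i, w i * x i) + b := rfl
  rw [h]
  constructor <;> intro h <;> linarith

theorem upper2_holds {x : Fin η → ℝ} {y z : ℝ} :
    (upper2 α w b L U).Holds (x, y, z) ↔
      y ≤ α * affine w b x - (α - 1) * Mplus (affine w b) (Set.Icc L U) * z := by
  simp only [LinIneq.Holds, LinIneq.violation, upper2]
  simp only [neg_mul, Finset.sum_neg_distrib, mul_assoc, ← Finset.mul_sum]
  have h : affine w b x = (∑ i, w i * x i) + b := rfl
  rw [h]
  constructor <;> intro h <;> linarith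

theorem box_holds {x : Fin η → ℝ} {y z : ℝ} :
    ((∀ i, (boxLower L i).Holds (x, y, z)) ∧ (∀ i, (boxUpper U i).Holds (x, y, z))) ↔
      x ∈ Set.Icc L U := by
  simp [LinIneq.Holds, LinIneq.violation, boxLower, boxUpper, ite_mul, Set.mem_Icc, Pi.le_def]

theorem z_holds {x : Fin η → ℝ} {y z : ℝ} :
    ((zLower : LinIneq η).Holds (x, y, z) ∧ (zUpper : LinIneq η).Holds (x, y, z)) ↔
      z ∈ Set.Icc (0 : ℝ) 1 := by
  simp [LinIneq.Holds, LinIneq.violation, zLower, zUpper, Set.mem_Icc]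

theorem cut_holds {x : Fin η → ℝ} {y z : ℝ} {I : Finset (Fin η)} :
    (cut α w b L U I).Holds (x, y, z) ↔
      y ≤ ((∑ i ∈ I, w i * (x i - breveL w L U i * (1 - z)))
            + (b + ∑ i ∈ Iᶜ, w i * breveU w L U i) * z)
          + α * ((∑ i ∈ Iᶜ, w i * (x i - breveU w L U i * z))
            + (b + ∑ i ∈ I, w i * breveL w L U i) * (1 - z)) := by
  have h1 : ∑ i, (if i ∈ I then -w i else -(α * w i)) * x i
      = -(∑ i ∈ I, w i * x i) - α * ∑ i ∈ Iᶜ, w i * x i := by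
    rw [← Finset.sum_add_sum_compl I, Finset.mul_sum, ← Finset.sum_neg_distrib, sub_eq_add_neg,
      ← Finset.sum_neg_distrib]
    congr 1
    · exact Finset.sum_congr rfl fun i hi => by simp [hi]
    · exact Finset.sum_congr rfl fun i hi => by
        rw [if_neg (Finset.mem_compl.1 hi)]; ring
  have h2 : ∑ i ∈ I, w i * (x i - breveL w L U i * (1 - z))
      = (∑ i ∈ I, w i * x i) - (∑ i ∈ I, w i * breveL w L U i) * (1 - z) := by
    rw [Finset.sum_mul, ← Finset.sum_sub_distrib]
    exact Finset.sum_congr rfl fun i _ => by ring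
  have h3 : ∑ i ∈ Iᶜ, w i * (x i - breveU w L U i * z)
      = (∑ i ∈ Iᶜ, w i * x i) - (∑ i ∈ Iᶜ, w i * breveU w L U i) * z := by
    rw [Finset.sum_mul, ← Finset.sum_sub_distrib]
    exact Finset.sum_congr rfl fun i _ => by ring
  simp only [LinIneq.Holds, LinIneq.violation, cut]
  rw [h1, h2, h3]
  constructor <;> intro h <;> linarith

end Inequalities

/-! ### Real RAM programs with unit cost, and the separation problem -/

/-- The memory of a real RAM: real registers, index registers, and arrays of reals. -/
structure State where
  reg : ℕ → ℝ
  idx : ℕ → ℕ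
  arr : ℕ → ℕ → ℝ

/-- The elementary instructions. The array that is accessed is fixed by the instruction, the
position in the array is the content of an index register. -/
inductive Instr where
  | const (r : ℕ) (q : ℚ)
  | copy (r s : ℕ)
  | add (r s t : ℕ)
  | sub (r s t : ℕ)
  | mul (r s t : ℕ)
  | load (r a k : ℕ)
  | store (a k r : ℕ)
  | idxConst (k n : ℕ)
  | idxCopy (k l : ℕ)
  | idxSucc (k : ℕ)

/-- The effect of an elementary instruction. -/
def Instr.apply : Instr → State → State
  | .const r q, σ => { σ with reg := Function.update σ.reg r (q : ℝ) }
  | .copy r s, σ => { σ with reg := Function.update σ.reg r (σ.reg s) }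
  | .add r s t, σ => { σ with reg := Function.update σ.reg r (σ.reg s + σ.reg t) }
  | .sub r s t, σ => { σ with reg := Function.update σ.reg r (σ.reg s - σ.reg t) }
  | .mul r s t, σ => { σ with reg := Function.update σ.reg r (σ.reg s * σ.reg t) }
  | .load r a k, σ => { σ with reg := Function.update σ.reg r (σ.arr a (σ.idx k)) }
  | .store a k r, σ =>
      { σ with arr := Function.update σ.arr a (Function.update (σ.arr a) (σ.idx k) (σ.reg r)) }
  | .idxConst k n, σ => { σ with idx := Function.update σ.idx k n }
  | .idxCopy k l, σ => { σ with idx := Function.update σ.idx k (σ.idx l) }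
  | .idxSucc k, σ => { σ with idx := Function.update σ.idx k (σ.idx k + 1) }

/-- Programs: instructions, sequencing, branching on `reg r ≤ reg s`, and loops that are repeated
as long as `idx k < idx l`. -/
inductive Program where
  | instr (i : Instr)
  | seq (P Q : Program)
  | ifLe (r s : ℕ) (P Q : Program)
  | whileLt (k l : ℕ) (P : Program)

/-- `Runs P σ t τ`: started in `σ`, the program `P` halts in the state `τ` after `t` steps; each
elementary instruction and each test is one step. -/
inductive Runs : Program → State → ℕ → State → Prop where
  | instr (i : Instr) (σ : State) : Runs (.instr i) σ 1 (i.apply σ)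
  | seq {P Q : Program} {σ τ υ : State} {t u : ℕ} :
      Runs P σ t τ → Runs Q τ u υ → Runs (.seq P Q) σ (t + u) υ
  | ifTrue {r s : ℕ} {P Q : Program} {σ τ : State} {t : ℕ} :
      σ.reg r ≤ σ.reg s → Runs P σ t τ → Runs (.ifLe r s P Q) σ (t + 1) τ
  | ifFalse {r s : ℕ} {P Q : Program} {σ τ : State} {t : ℕ} :
      ¬ σ.reg r ≤ σ.reg s → Runs Q σ t τ → Runs (.ifLe r s P Q) σ (t + 1) τ
  | whileDone {k l : ℕ} {P : Program} {σ : State} :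
      ¬ σ.idx k < σ.idx l → Runs (.whileLt k l P) σ 1 σ
  | whileStep {k l : ℕ} {P : Program} {σ τ υ : State} {t u : ℕ} :
      σ.idx k < σ.idx l → Runs P σ t τ → Runs (.whileLt k l P) τ u υ →
        Runs (.whileLt k l P) σ (t + u + 1) υ

/-- The vector `v` as the beginning of an array that is `0` elsewhere. -/
def toArray {η : ℕ} (v : Fin η → ℝ) (n : ℕ) : ℝ := if h : n < η then v ⟨n, h⟩ else 0

/-- The input of the separation routine: `η` in index register `0`; `α`, `b`, `y`, `z` in the real
registers `0` to `3`; `w`, `L`, `U`, `x` in the arrays `0` to `3`; everything else is `0`. -/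
def inputState {η : ℕ} (α : ℝ) (w : Fin η → ℝ) (b : ℝ) (L U : Fin η → ℝ) (p : Point η) : State where
  reg
    | 0 => α
    | 1 => b
    | 2 => p.2.1
    | 3 => p.2.2
    | _ => 0
  idx
    | 0 => η
    | _ => 0
  arr
    | 0 => toArray w
    | 1 => toArray L
    | 2 => toArray U
    | 3 => toArray p.1
    | _ => fun _ => 0

/-- The output of the separation routine: index register `1` tells whether an inequality is
returned; if so, its coefficients are in array `4` and in the real registers `4` to `6`. -/
def output (η : ℕ) (σ : State) : Option (LinIneq η) :=
  if σ.idx 1 = 0 then none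
  else some ⟨fun i => σ.arr 4 i, σ.reg 4, σ.reg 5, σ.reg 6⟩

/-- A correct answer to the separation problem for the family `F` at `p`: either a most violated
inequality of the family, or `none` if no inequality of the family is violated. -/
def IsSeparationAnswer {η : ℕ} (F : Set (LinIneq η)) (p : Point η) :
    Option (LinIneq η) → Prop
  | none => ∀ c ∈ F, c.Holds p
  | some c => c ∈ F ∧ ¬ c.Holds p ∧ ∀ c' ∈ F, c'.violation p ≤ c.violation p

end LeakyReLU

end

open LeakyReLU

noncomputable section

namespace LeakyReLU

variable {η : ℕ} {α : ℝ} {w : Fin η → ℝ} {b : ℝ} {L U : Fin η → ℝ}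

/-! ### The extreme values of an affine function on a box -/

/-! Everything rests on `leaky α v = α * v + (1 - α) * max 0 v`. With `u = (y - α * f x) / (1 - α)`
the cuts become upper bounds on `u`, as for the ordinary ReLU. `upper1` and `upper2` are the cuts of
the full and the empty index set (`upper1_eq_cut`, `upper2_eq_cut`).

For fixed `(x, z)` the bound given by `I` is a sum in which each coordinate contributes one of two
terms, so the strongest cut takes the smaller term in each coordinate (`selected`). If `0 < z < 1`,
its bound is `z * f x₁`, where `x = z • x₁ + (1 - z) • x₀` is the split inside the box that makes `f
x₁` largest (`exists_maximal_split`). Sliding from the trivial split to this one reaches a split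
with `z * f p₁ = u`; then `f p₁ ≥ 0 ≥ f p₀`, and the point is a proper convex combination of integer
feasible points. Hence no extreme point has fractional `z`.

Facets come from a count of directions. A cut is tight at `z = 1` when the coordinates outside `I`
are at `breveU`, and at `z = 0` when those in `I` are at `breveL`. By irreducibility `f` is strictly
positive, respectively negative, at these corners, so every nondegenerate coordinate can move on one
of the two levels.

The coordinatewise choice of `I` is also the linear-time separation algorithm. -/

theorem breveL_mem (h : L ≤ U) : breveL w L U ∈ Set.Icc L U := by
  constructor <;> intro i <;> have := h i <;> simp only [breveL] <;> split_ifs <;> simp [this]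

theorem breveU_mem (h : L ≤ U) : breveU w L U ∈ Set.Icc L U := by
  constructor <;> intro i <;> have := h i <;> simp only [breveU] <;> split_ifs <;> simp [this]

theorem mul_breveL_le {x : Fin η → ℝ} (hx : x ∈ Set.Icc L U) (i : Fin η) :
    w i * breveL w L U i ≤ w i * x i := by
  have h1 := hx.1 i
  have h2 := hx.2 i
  simp only [breveL]
  split_ifs with hw
  · exact mul_le_mul_of_nonneg_left h1 hw
  · exact mul_le_mul_of_nonpos_left h2 (not_le.1 hw).le

theorem le_mul_breveU {x : Fin η → ℝ} (hx : x ∈ Set.Icc L U) (i : Fin η) :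
    w i * x i ≤ w i * breveU w L U i := by
  have h1 := hx.1 i
  have h2 := hx.2 i
  simp only [breveU]
  split_ifs with hw
  · exact mul_le_mul_of_nonneg_left h2 hw
  · exact mul_le_mul_of_nonpos_left h1 (not_le.1 hw).le

theorem affine_breveL_le {x : Fin η → ℝ} (hx : x ∈ Set.Icc L U) :
    affine w b (breveL w L U) ≤ affine w b x :=
  add_le_add_left (Finset.sum_le_sum fun i _ => mul_breveL_le hx i) b

theorem affine_le_breveU {x : Fin η → ℝ} (hx : x ∈ Set.Icc L U) :
    affine w b x ≤ affine w b (breveU w L U) :=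
  add_le_add_left (Finset.sum_le_sum fun i _ => le_mul_breveU hx i) b

theorem Mminus_eq (h : L ≤ U) :
    Mminus (affine w b) (Set.Icc L U) = affine w b (breveL w L U) :=
  (Mminus_isLeast w b h).unique
    ⟨⟨_, breveL_mem h, rfl⟩, fun _ ⟨_, hx, hy⟩ => hy ▸ affine_breveL_le hx⟩

theorem Mplus_eq (h : L ≤ U) :
    Mplus (affine w b) (Set.Icc L U) = affine w b (breveU w L U) :=
  (Mplus_isGreatest w b h).unique
    ⟨⟨_, breveU_mem h, rfl⟩, fun _ ⟨_, hx, hy⟩ => hy ▸ affine_le_breveU hx⟩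

theorem affine_lineComb (x x' : Fin η → ℝ) (s t : ℝ) (hst : s + t = 1) :
    affine w b (s • x + t • x') = s * affine w b x + t * affine w b x' := by
  have : ∑ i, w i * (s * x i + t * x' i) = s * ∑ i, w i * x i + t * ∑ i, w i * x' i := by
    rw [Finset.mul_sum, Finset.mul_sum, ← Finset.sum_add_distrib]
    exact Finset.sum_congr rfl fun i _ => by ring
  simp only [affine, Pi.add_apply, Pi.smul_apply, smul_eq_mul, this]
  linear_combination -b * hst

/-! ### The exponential family -/

theorem sum_compl_eq_sum_ite (I : Finset (Fin η)) (v : Fin η → ℝ) :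
    ∑ i ∈ Iᶜ, v i = ∑ i, if i ∈ I then 0 else v i := by
  rw [← Finset.sum_add_sum_compl I, Finset.sum_eq_zero (s := I), zero_add]
  · exact Finset.sum_congr rfl fun i hi => by simp [Finset.mem_compl.1 hi]
  · intro i hi; simp [hi]

/-- The form used throughout: after division by `1 - α` the cut bounds the ReLU part of `y` by a sum
in which `I` only selects one of two terms per coordinate. -/
theorem cut_violation (I : Finset (Fin η)) (x : Fin η → ℝ) (y z : ℝ) :
    (cut α w b L U I).violation (x, y, z) = y - α * affine w b x
      - (1 - α) * ((∑ i, if i ∈ I then w i * (x i - breveL w L U i * (1 - z))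
          else w i * breveU w L U i * z) + b * z) := by
  have e1 : ∑ i ∈ I, w i * breveL w L U i = ∑ i, if i ∈ I then w i * breveL w L U i else 0 := by
    simp
  have key : ∑ i, (if i ∈ I then w i * (x i - breveL w L U i * (1 - z))
          else w i * breveU w L U i * z) * (1 - α)
      = -(∑ i, (if i ∈ I then -w i else -(α * w i)) * x i) - α * ∑ i, w i * x i
        - (1 - α) * (1 - z) * (∑ i, if i ∈ I then w i * breveL w L U i else 0)
        + (1 - α) * z * (∑ i, if i ∈ I then 0 else w i * breveU w L U i) := by
    simp only [Finset.mul_sum, ← Finset.sum_neg_distrib, ← Finset.sum_sub_distrib,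
      ← Finset.sum_add_distrib]
    exact Finset.sum_congr rfl fun i _ => by split_ifs <;> ring
  rw [← Finset.sum_mul] at key
  simp only [LinIneq.violation, cut, affine]
  rw [e1, sum_compl_eq_sum_ite]
  linear_combination key

theorem upper1_eq_cut (h : L ≤ U) : upper1 α w b L U = cut α w b L U Finset.univ := by
  simp only [upper1, cut, Mminus_eq h, affine, Finset.mem_univ, if_true, Finset.compl_univ,
    Finset.sum_empty, LinIneq.mk.injEq, true_and]
  constructor <;> ring

theorem upper2_eq_cut (h : L ≤ U) : upper2 α w b L U = cut α w b L U ∅ := by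
  simp only [upper2, cut, Mplus_eq h, affine, Finset.notMem_empty, if_false, Finset.compl_empty,
    Finset.sum_empty, LinIneq.mk.injEq, true_and]
  constructor <;> ring

/-- On the graph at `z = 1` the slack is a sum of the gaps up to `breveU` outside `I`. This shows
both validity and where the cut is tight; `cut_violation_zero` is the counterpart at `z = 0`. -/
theorem cut_violation_one (I : Finset (Fin η)) (x : Fin η → ℝ) (y : ℝ) :
    (cut α w b L U I).violation (x, y, 1) = y - affine w b x
      - (1 - α) * ∑ i, if i ∈ I then 0 else w i * breveU w L U i - w i * x i := by
  have : (∑ i, if i ∈ I then w i * (x i - breveL w L U i * (1 - 1))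
        else w i * breveU w L U i * 1)
      = (∑ i, w i * x i) + ∑ i, if i ∈ I then 0 else w i * breveU w L U i - w i * x i := by
    rw [← Finset.sum_add_distrib]
    exact Finset.sum_congr rfl fun i _ => by split_ifs <;> ring
  rw [cut_violation, this, affine]
  ring

theorem cut_violation_zero (I : Finset (Fin η)) (x : Fin η → ℝ) (y : ℝ) :
    (cut α w b L U I).violation (x, y, 0) = y - α * affine w b x
      - (1 - α) * ∑ i, if i ∈ I then w i * x i - w i * breveL w L U i else 0 := by
  rw [cut_violation]
  congr 2
  rw [mul_zero, add_zero]
  exact Finset.sum_congr rfl fun i _ => by split_ifs <;> ring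

/-! ### Validity -/

theorem mem_relaxation_bigM {x : Fin η → ℝ} {y z : ℝ} :
    (x, y, z) ∈ relaxation (bigM α w b L U) ↔
      ((lower1 w b).Holds (x, y, z) ∧ (lower2 α w b).Holds (x, y, z) ∧
        (upper1 α w b L U).Holds (x, y, z) ∧ (upper2 α w b L U).Holds (x, y, z)) ∧
      x ∈ Set.Icc L U ∧ z ∈ Set.Icc (0 : ℝ) 1 := by
  rw [← box_holds (y := y) (z := z), ← z_holds (x := x) (y := y)]
  simp only [relaxation, bigM, bigMCore, Set.mem_ofPred_eq, Set.mem_union, or_imp, forall_and,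
    Set.forall_mem_range, Set.mem_insert_iff, Set.mem_singleton_iff, forall_eq]

/-- The integer feasible points over `z = 0` and over `z = 1`. -/
theorem mem_integerPoints_bigM (hα : α < 1) (h : L ≤ U) {x : Fin η → ℝ} {y z : ℝ} :
    (x, y, z) ∈ integerPoints (bigM α w b L U) ↔
      x ∈ Set.Icc L U ∧ ((z = 0 ∧ y = α * affine w b x ∧ affine w b x ≤ 0) ∨
        (z = 1 ∧ y = affine w b x ∧ 0 ≤ affine w b x)) := by
  simp only [integerPoints, Set.mem_ofPred_eq, mem_relaxation_bigM, lower1_holds, lower2_holds,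
    upper1_holds, upper2_holds, Mplus_eq h, Mminus_eq h]
  have hα' : 0 < 1 - α := by linarith
  constructor
  · rintro ⟨⟨⟨h1, h2, h3, h4⟩, hx, -⟩, rfl | rfl⟩
    -- At `z = 0`, `lower2` and `upper2` pinch `y` to `α * f x`, and `lower1` then forces `(1 - α) *
    -- f x ≤ 0`. The level `z = 1` is symmetric.
    · refine ⟨hx, Or.inl ⟨rfl, by linarith, ?_⟩⟩
      by_contra hf
      nlinarith [mul_pos hα' (not_le.1 hf)]
    · refine ⟨hx, Or.inr ⟨rfl, by linarith, ?_⟩⟩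
      by_contra hf
      nlinarith [mul_pos hα' (neg_pos.2 (not_le.1 hf))]
  · rintro ⟨hx, ⟨rfl, rfl, hf⟩ | ⟨rfl, rfl, hf⟩⟩
    · have := mul_le_mul_of_nonneg_left (affine_breveL_le (w := w) (b := b) hx) hα'.le
      have := mul_nonneg hα'.le (neg_nonneg.2 hf)
      exact ⟨⟨⟨by linarith, by linarith, by linarith, by linarith⟩, hx, by simp⟩, by simp⟩
    · have := mul_le_mul_of_nonneg_left (affine_le_breveU (w := w) (b := b) hx) hα'.le
      have := mul_nonneg hα'.le hf
      exact ⟨⟨⟨by linarith, by linarith, by linarith, by linarith⟩, hx, by simp⟩, by simp⟩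

theorem cut_holds_of_mem (hα : α < 1) (h : L ≤ U) (I : Finset (Fin η)) {p : Point η}
    (hp : p ∈ integerPoints (bigM α w b L U)) : (cut α w b L U I).Holds p := by
  obtain ⟨x, y, z⟩ := p
  have hα' : 0 ≤ 1 - α := by linarith
  obtain ⟨hx, ⟨rfl, rfl, hf⟩ | ⟨rfl, rfl, hf⟩⟩ := (mem_integerPoints_bigM hα h).1 hp
  · rw [LinIneq.Holds, cut_violation_zero, sub_self, zero_sub, neg_nonpos]
    refine mul_nonneg hα' (Finset.sum_nonneg fun i _ => ?_)
    split_ifs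
    · exact sub_nonneg.2 (mul_breveL_le hx i)
    · exact le_rfl
  · rw [LinIneq.Holds, cut_violation_one, sub_self, zero_sub, neg_nonpos]
    refine mul_nonneg hα' (Finset.sum_nonneg fun i _ => ?_)
    split_ifs
    · exact le_rfl
    · exact sub_nonneg.2 (le_mul_breveU hx i)

/-- Cuts valid on all integer points remove none of them, so validity and facets need to be studied
for the big-M system only. -/
theorem integerPoints_union_cuts (hα : α < 1) (h : L ≤ U) :
    integerPoints (bigM α w b L U ∪ cuts α w b L U) = integerPoints (bigM α w b L U) := by
  ext p
  refine ⟨fun hp => ⟨fun c hc => hp.1 c (Or.inl hc), hp.2⟩, fun hp => ⟨?_, hp.2⟩⟩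
  rintro c (hc | ⟨I, rfl⟩)
  · exact hp.1 c hc
  · exact cut_holds_of_mem hα h I hp

theorem bigM_finite : (bigM α w b L U).Finite :=
  (Set.toFinite {lower1 w b, lower2 α w b, upper1 α w b L U, upper2 α w b L U}).union
    (((Set.finite_range _).union (Set.finite_range _)).union (Set.toFinite _))

theorem cuts_finite : (cuts α w b L U).Finite := Set.finite_range _

theorem graph_eq_image (hα : α < 1) (h : L ≤ U) :
    graph (leaky α ∘ affine w b) (Set.Icc L U)
      = (fun p : Point η => (p.1, p.2.1)) '' integerPoints (bigM α w b L U) := by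
  ext ⟨x, y⟩
  have hα' : 0 < 1 - α := by linarith
  simp only [graph, Set.mem_ofPred_eq, Function.comp_apply, leaky, Set.mem_image, Prod.exists,
    mem_integerPoints_bigM hα h, Prod.mk.injEq]
  constructor
  · rintro ⟨hx, rfl⟩
    rcases le_total (affine w b x) 0 with hf | hf
    · refine ⟨x, _, 0, ⟨hx, Or.inl ⟨rfl, rfl, hf⟩⟩, rfl, (max_eq_left ?_).symm⟩
      nlinarith
    · refine ⟨x, _, 1, ⟨hx, Or.inr ⟨rfl, rfl, hf⟩⟩, rfl, (max_eq_right ?_).symm⟩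
      nlinarith
  · rintro ⟨x, y, z, ⟨hx, ⟨rfl, rfl, hf⟩ | ⟨rfl, rfl, hf⟩⟩, rfl, rfl⟩
    · exact ⟨hx, (max_eq_left (by nlinarith)).symm⟩
    · exact ⟨hx, (max_eq_right (by nlinarith)).symm⟩

theorem isFormulation_bigM (hα : α < 1) (h : L ≤ U) :
    IsFormulation (bigM α w b L U) (graph (leaky α ∘ affine w b) (Set.Icc L U)) :=
  ⟨bigM_finite, graph_eq_image hα h⟩

theorem isFormulation_union_cuts (hα : α < 1) (h : L ≤ U) :
    IsFormulation (bigM α w b L U ∪ cuts α w b L U)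
      (graph (leaky α ∘ affine w b) (Set.Icc L U)) :=
  ⟨bigM_finite.union cuts_finite, by rw [integerPoints_union_cuts hα h, graph_eq_image hα h]⟩

/-! ### Idealness -/

/-- A point `x` of the box is a convex combination with weight `z` of points `x₁`, `x₀` of the box
such that, in each coordinate, `w i * x₁ i` is as large as possible. -/
theorem exists_maximal_split (h : L ≤ U) {x : Fin η → ℝ} (hx : x ∈ Set.Icc L U) {z : ℝ}
    (hz : 0 < z) (hz' : z < 1) :
    ∃ x₁ ∈ Set.Icc L U, ∃ x₀ ∈ Set.Icc L U, z • x₁ + (1 - z) • x₀ = x ∧ ∀ i,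
      z * (w i * x₁ i) = min (w i * (x i - breveL w L U i * (1 - z))) (w i * breveU w L U i * z) := by
  have hz1 : 0 < 1 - z := by linarith
  have main : ∀ i, ∃ s t : ℝ, (L i ≤ s ∧ s ≤ U i) ∧ (L i ≤ t ∧ t ≤ U i) ∧
      z * s + (1 - z) * t = x i ∧ z * (w i * s)
        = min (w i * (x i - breveL w L U i * (1 - z))) (w i * breveU w L U i * z) := by
    intro i
    have h1 := hx.1 i
    have h2 := hx.2 i
    by_cases hw : 0 ≤ w i
    · simp only [breveL, breveU, if_pos hw]
      rcases le_total (x i - L i * (1 - z)) (U i * z) with hc | hc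
      -- Put the `x₀` coordinate at its `breveL` end if the `x₁` coordinate then stays in its
      -- interval; otherwise `x₁` takes its `breveU` end and `x₀` the remainder.
      · refine ⟨(x i - L i * (1 - z)) / z, L i, ⟨?_, ?_⟩, ⟨le_rfl, h i⟩, by field_simp; ring, ?_⟩
        · rw [le_div_iff₀ hz]; linarith
        · rwa [div_le_iff₀ hz]
        · rw [mul_assoc, min_eq_left (mul_le_mul_of_nonneg_left hc hw)]; field_simp
      · refine ⟨U i, (x i - U i * z) / (1 - z), ⟨h i, le_rfl⟩, ⟨?_, ?_⟩, by field_simp; ring, ?_⟩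
        · rwa [le_div_iff₀ hz1, le_sub_iff_add_le, add_comm, ← le_sub_iff_add_le]
        · rw [div_le_iff₀ hz1]; linarith
        · rw [mul_assoc (w i) (U i), min_eq_right (mul_le_mul_of_nonneg_left hc hw)]; ring
    · simp only [breveL, breveU, if_neg hw]
      have hw' := (not_le.1 hw).le
      rcases le_total (L i * z) (x i - U i * (1 - z)) with hc | hc
      · refine ⟨(x i - U i * (1 - z)) / z, U i, ⟨?_, ?_⟩, ⟨h i, le_rfl⟩, by field_simp; ring, ?_⟩
        · rwa [le_div_iff₀ hz]
        · rw [div_le_iff₀ hz]; linarith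
        · rw [mul_assoc, min_eq_left (mul_le_mul_of_nonpos_left hc hw')]; field_simp
      · refine ⟨L i, (x i - L i * z) / (1 - z), ⟨le_rfl, h i⟩, ⟨?_, ?_⟩, by field_simp; ring, ?_⟩
        · rw [le_div_iff₀ hz1]; linarith
        · rw [div_le_iff₀ hz1]; linarith
        · rw [mul_assoc (w i) (L i), min_eq_right (mul_le_mul_of_nonpos_left hc hw')]; ring
  choose s t hs ht hst hm using main
  exact ⟨s, ⟨fun i => (hs i).1, fun i => (hs i).2⟩, t, ⟨fun i => (ht i).1, fun i => (ht i).2⟩,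
    funext hst, hm⟩

variable (w L U) in
/-- The index set of the inequality of the exponential family whose right-hand side is smallest at
the given point. -/
def selected (p : Point η) : Finset (Fin η) := by
  classical
  exact Finset.univ.filter fun i : Fin η =>
    w i * (p.1 i - breveL w L U i * (1 - p.2.2)) ≤ w i * breveU w L U i * p.2.2

theorem mem_selected {p : Point η} {i : Fin η} :
    i ∈ selected w L U p ↔
      w i * (p.1 i - breveL w L U i * (1 - p.2.2)) ≤ w i * breveU w L U i * p.2.2 := by
  simp [selected]

theorem cut_violation_selected (x : Fin η → ℝ) (y z : ℝ) :
    (cut α w b L U (selected w L U (x, y, z))).violation (x, y, z) = y - α * affine w b x - (1 - α) *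
      ((∑ i, min (w i * (x i - breveL w L U i * (1 - z))) (w i * breveU w L U i * z)) + b * z) := by
  simp only [cut_violation, mem_selected, min_def]

/-- The bound is minimized over `I` one coordinate at a time, and `1 - α` is nonnegative. -/
theorem cut_violation_le_selected (hα : α < 1) (I : Finset (Fin η)) (p : Point η) :
    (cut α w b L U I).violation p ≤ (cut α w b L U (selected w L U p)).violation p := by
  obtain ⟨x, y, z⟩ := p
  rw [cut_violation_selected, cut_violation]
  refine sub_le_sub_left (mul_le_mul_of_nonneg_left (add_le_add_left
    (Finset.sum_le_sum fun i _ => ?_) _) (by linarith)) _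
  split_ifs
  · exact min_le_left _ _
  · exact min_le_right _ _

theorem extremePoint_binary (hα : α < 1) (h : L ≤ U) {p : Point η}
    (hp : p ∈ Set.extremePoints ℝ (relaxation (bigM α w b L U ∪ cuts α w b L U))) :
    p.2.2 = 0 ∨ p.2.2 = 1 := by
  obtain ⟨x, y, z⟩ := p
  obtain ⟨hmem, hext⟩ := hp
  have hα' : 0 < 1 - α := by linarith
  obtain ⟨⟨h1, h2, -, -⟩, hx, hz0, hz1⟩ := mem_relaxation_bigM.1
    (show (x, y, z) ∈ relaxation (bigM α w b L U) from fun c hc => hmem c (Or.inl hc))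
  rw [lower1_holds] at h1
  rw [lower2_holds] at h2
  by_contra! hne
  have hz : 0 < z := lt_of_le_of_ne hz0 hne.1.symm
  have hz' : 0 < 1 - z := by linarith [lt_of_le_of_ne hz1 hne.2]
  obtain ⟨x₁, hx₁, x₀, hx₀, hsplit, hmax⟩ :=
    exists_maximal_split (w := w) h hx hz (by linarith : z < 1)
  have hcut := hmem _ (Or.inr ⟨selected w L U (x, y, z), rfl⟩)
  rw [LinIneq.Holds, cut_violation_selected] at hcut
  simp only [← hmax, ← Finset.mul_sum] at hcut
  -- The ReLU part of `y`: `lower2` gives `0 ≤ u`, `lower1` gives `f x ≤ u`, and the selected cut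
  -- gives `u ≤ z * f x₁`.
  set u := (y - α * affine w b x) / (1 - α) with hu
  have hyu : y = (1 - α) * u + α * affine w b x := by rw [hu]; field_simp; ring
  have hu0 : 0 ≤ u := div_nonneg (by linarith) hα'.le
  have huf : affine w b x ≤ u := by
    rw [hu, le_div_iff₀ hα']; linarith
  have hu1 : u ≤ z * affine w b x₁ := by
    rw [hu, div_le_iff₀ hα']
    simp only [affine] at hcut ⊢
    linarith
  have hfx : z * affine w b x₁ + (1 - z) * affine w b x₀ = affine w b x := by
    rw [← hsplit, affine_lineComb _ _ _ _ (by ring)]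
  have hlow : z * affine w b x ≤ u := by
    rcases le_total (affine w b x) 0 with hf | hf
    · nlinarith
    · nlinarith
  -- Interpolate between the trivial split `(x, x)` and the maximal one `(x₁, x₀)` until `z` times
  -- the value at the first point is exactly `u`.
  obtain ⟨s, t, hs, ht, hst, hcomb⟩ : ∃ s t : ℝ, 0 ≤ s ∧ 0 ≤ t ∧ s + t = 1 ∧
      s * (z * affine w b x) + t * (z * affine w b x₁) = u := by
    have : u ∈ segment ℝ (z * affine w b x) (z * affine w b x₁) := by
      rw [segment_eq_Icc (hlow.trans hu1)]; exact ⟨hlow, hu1⟩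
    simpa [segment, smul_eq_mul] using this
  have hconv : Convex ℝ (Set.Icc L U) := convex_Icc L U
  set p₁ := s • x + t • x₁
  set p₀ := s • x + t • x₀
  have hp₁ : p₁ ∈ Set.Icc L U := hconv hx hx₁ hs ht hst
  have hp₀ : p₀ ∈ Set.Icc L U := hconv hx hx₀ hs ht hst
  have hfp₁ : z * affine w b p₁ = u := by
    rw [affine_lineComb _ _ _ _ hst]; linarith
  have hpx : z • p₁ + (1 - z) • p₀ = x := by
    calc z • p₁ + (1 - z) • p₀ = s • x + t • (z • x₁ + (1 - z) • x₀) := by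
          simp only [p₁, p₀]; module
      _ = x := by rw [hsplit, ← add_smul, hst, one_smul]
  have hfp₀ : (1 - z) * affine w b p₀ = affine w b x - u := by
    have := affine_lineComb (w := w) (b := b) p₁ p₀ z (1 - z) (by ring)
    rw [hpx] at this
    linarith
  -- The signs needed on the two levels come from `0 ≤ u` and from `f x ≤ u`.
  have q₁ : (p₁, affine w b p₁, (1 : ℝ)) ∈ integerPoints (bigM α w b L U) :=
    (mem_integerPoints_bigM hα h).2 ⟨hp₁, Or.inr ⟨rfl, rfl,
      nonneg_of_mul_nonneg_right (hfp₁ ▸ hu0) hz⟩⟩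
  have q₀ : (p₀, α * affine w b p₀, (0 : ℝ)) ∈ integerPoints (bigM α w b L U) :=
    (mem_integerPoints_bigM hα h).2 ⟨hp₀, Or.inl ⟨rfl, rfl,
      nonpos_of_mul_nonpos_right (a := 1 - z) (by linarith) hz'⟩⟩
  rw [← integerPoints_union_cuts hα h] at q₀ q₁
  have := hext q₁.1 q₀.1 ⟨z, 1 - z, hz, hz', by ring, ?_⟩
  · exact hne.2 (congrArg (fun q : Point η => q.2.2) this).symm
  · refine Prod.ext hpx (Prod.ext ?_ ?_)
    · simp only [Prod.snd_add, Prod.fst_add, Prod.smul_mk, smul_eq_mul]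
      linear_combination hfp₁ + α * hfp₀ - hyu
    · simp

theorem isIdealFormulation_union_cuts (hα : α < 1) (h : L ≤ U) :
    IsIdealFormulation (bigM α w b L U ∪ cuts α w b L U)
      (graph (leaky α ∘ affine w b) (Set.Icc L U)) :=
  ⟨isFormulation_union_cuts hα h, fun _ hp => extremePoint_binary hα h hp⟩

/-! ### Facets -/

/-- The linear part of an inequality. -/
def LinIneq.linear (c : LinIneq η) : Point η →ₗ[ℝ] ℝ where
  toFun p := (∑ i, c.cx i * p.1 i) + c.cy * p.2.1 + c.cz * p.2.2
  map_add' p q := by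
    simp only [Prod.fst_add, Prod.snd_add, Pi.add_apply, mul_add, Finset.sum_add_distrib]
    ring
  map_smul' r p := by
    simp only [Prod.smul_fst, Prod.smul_snd, Pi.smul_apply, smul_eq_mul, RingHom.id_apply,
      mul_left_comm _ r, ← Finset.mul_sum]
    ring

theorem LinIneq.violation_eq (c : LinIneq η) (p : Point η) :
    c.violation p = c.linear p - c.rhs := rfl

variable (L U) in
/-- The direction of the affine hull of the integer feasible points of an irreducible neuron: the
coordinates whose interval is a single point do not vary. -/
def boxDirection : Submodule ℝ (Point η) where
  carrier := {p | ∀ i, L i = U i → p.1 i = 0}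
  add_mem' {p q} hp hq i hi := by simp [hp i hi, hq i hi]
  zero_mem' := fun i _ => rfl
  smul_mem' r p hp i hi := by simp [hp i hi]

theorem vectorSpan_integerPoints_le (hα : α < 1) (h : L ≤ U) :
    vectorSpan ℝ (integerPoints (bigM α w b L U)) ≤ boxDirection L U := by
  rw [vectorSpan_def, Submodule.span_le]
  rintro _ ⟨⟨x, y, z⟩, hp, ⟨x', y', z'⟩, hq, rfl⟩ i hi
  have hx := ((mem_integerPoints_bigM hα h).1 hp).1
  have hx' := ((mem_integerPoints_bigM hα h).1 hq).1
  have h1 := hx.1 i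
  have h2 := hx.2 i
  have h3 := hx'.1 i
  have h4 := hx'.2 i
  change x i - x' i = 0
  linarith

/-- The points of the formulation at which `c` is tight. -/
def tightPoints (α : ℝ) (w : Fin η → ℝ) (b : ℝ) (L U : Fin η → ℝ) (c : LinIneq η) :
    Set (Point η) := {p | p ∈ integerPoints (bigM α w b L U) ∧ c.Tight p}

theorem vectorSpan_tightPoints_le (c : LinIneq η) :
    vectorSpan ℝ (tightPoints α w b L U c) ≤ LinearMap.ker c.linear := by
  rw [vectorSpan_def, Submodule.span_le]
  rintro _ ⟨p, ⟨-, hp⟩, q, ⟨-, hq⟩, rfl⟩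
  rw [LinIneq.Tight, LinIneq.violation_eq] at hp hq
  change c.linear (p - q) = 0
  rw [map_sub]
  linarith

/-- If the direction of the tight points contains a vector over each coordinate direction of the
box and a vector with a nonzero `z`, then it is all that it can be. -/
theorem inf_ker_le_vectorSpan {c : LinIneq η} (hc : c.cy ≠ 0) (g : Fin η → ℝ) {d : Point η}
    (hd : d ∈ vectorSpan ℝ (tightPoints α w b L U c)) (hd1 : d.2.2 = 1)
    (hdE : d ∈ boxDirection L U)
    (hg : ∀ i, L i ≠ U i →
      (Pi.single i 1, g i, 0) ∈ vectorSpan ℝ (tightPoints α w b L U c)) :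
    boxDirection L U ⊓ LinearMap.ker c.linear ≤ vectorSpan ℝ (tightPoints α w b L U c) := by
  rintro e ⟨heE, hek⟩
  set T := vectorSpan ℝ (tightPoints α w b L U c)
  -- Remove the `z`-component with `d`, then expand the `x`-part in the coordinate directions.
  set v : Point η := e - e.2.2 • d with hv
  have hvE : v ∈ boxDirection L U := sub_mem heE (Submodule.smul_mem _ _ hdE)
  set s : Point η := ∑ i, v.1 i • ((Pi.single i 1, g i, 0) : Point η) with hs
  have hsT : s ∈ T := by
    refine Submodule.sum_mem _ fun i _ => ?_
    by_cases hi : L i = U i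
    · rw [hvE i hi, zero_smul]; exact zero_mem _
    · exact Submodule.smul_mem _ _ (hg i hi)
  have hrT : e.2.2 • d + s ∈ T := add_mem (Submodule.smul_mem _ _ hd) hsT
  have hker : c.linear (e.2.2 • d + s) = 0 := vectorSpan_tightPoints_le c hrT
  have hs1 : s.1 = v.1 := by
    rw [hs, Prod.fst_sum]
    ext j
    simp [Finset.sum_apply, Pi.single_apply]
  have hs2 : s.2.2 = 0 := by
    rw [hs, Prod.snd_sum, Prod.snd_sum]
    simp
  have h1 : (e.2.2 • d + s).1 = e.1 := by
    rw [Prod.fst_add, hs1, hv, Prod.fst_sub]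
    abel
  have h2 : (e.2.2 • d + s).2.2 = e.2.2 := by
    simp [hs2, hd1]
  -- Both vectors lie in the kernel and agree in `x` and `z`; as `c.cy ≠ 0`, the `y`-component is
  -- determined.
  have h3 : (e.2.2 • d + s).2.1 = e.2.1 := by
    have hek' : c.linear e = 0 := hek
    simp only [LinIneq.linear, LinearMap.coe_mk, AddHom.coe_mk] at hker hek'
    rw [h1, h2] at hker
    exact mul_left_cancel₀ hc (by linarith)
  have : e = e.2.2 • d + s := Prod.ext h1.symm (Prod.ext h3.symm h2.symm)
  rw [this]
  exact hrT

/-- Rank-nullity for the restriction of `f` to `E`, which is onto `ℝ` since it is nonzero. -/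
theorem finrank_inf_ker_add_one {V : Type*} [AddCommGroup V] [Module ℝ V] [FiniteDimensional ℝ V]
    (E : Submodule ℝ V) (f : V →ₗ[ℝ] ℝ) {e : V} (he : e ∈ E) (hf : f e ≠ 0) :
    Module.finrank ℝ ↥(E ⊓ LinearMap.ker f) + 1 = Module.finrank ℝ E := by
  set f' : E →ₗ[ℝ] ℝ := f.domRestrict E
  have hsurj : LinearMap.range f' = ⊤ := by
    refine LinearMap.range_eq_top.2 (LinearMap.surjective fun h0 => hf ?_)
    exact LinearMap.congr_fun h0 ⟨e, he⟩
  have hrk := f'.finrank_range_add_finrank_ker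
  rw [hsurj, finrank_top, Module.finrank_self] at hrk
  have hmap : E ⊓ LinearMap.ker f = (LinearMap.ker f').map E.subtype := by
    ext x
    simp only [Submodule.mem_inf, LinearMap.mem_ker, Submodule.mem_map, Submodule.subtype_apply,
      Subtype.exists, exists_and_right, exists_eq_right, f', LinearMap.domRestrict_apply]
    exact ⟨fun ⟨h1, h2⟩ => ⟨h1, h2⟩, fun ⟨h1, h2⟩ => ⟨h1, h2⟩⟩
  rw [hmap, Submodule.finrank_map_subtype_eq]
  omega

theorem isFacetDefining_of_inf_ker_le {c : LinIneq η} (hc : c.cy ≠ 0)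
    (hA : vectorSpan ℝ (integerPoints (bigM α w b L U)) = boxDirection L U)
    (hvalid : IsValidIneq (bigM α w b L U) c) (htight : (tightPoints α w b L U c).Nonempty)
    (hspan : boxDirection L U ⊓ LinearMap.ker c.linear ≤
      vectorSpan ℝ (tightPoints α w b L U c)) :
    IsFacetDefining (bigM α w b L U) c := by
  refine ⟨hvalid, ?_⟩
  change setDim (tightPoints α w b L U c) = setDim (integerPoints (bigM α w b L U)) - 1
  have hTA : vectorSpan ℝ (tightPoints α w b L U c) ≤
      vectorSpan ℝ (integerPoints (bigM α w b L U)) :=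
    vectorSpan_mono ℝ fun p hp => hp.1
  have hT : vectorSpan ℝ (tightPoints α w b L U c) = boxDirection L U ⊓ LinearMap.ker c.linear :=
    le_antisymm (le_inf (hA ▸ hTA) (vectorSpan_tightPoints_le c)) hspan
  -- The unit vector in `y` lies in `boxDirection` and is mapped to `c.cy ≠ 0`.
  have hdim := finrank_inf_ker_add_one (boxDirection L U) c.linear (e := (0, 1, 0))
    (fun i _ => rfl) (by simpa [LinIneq.linear] using hc)
  have hAne : (integerPoints (bigM α w b L U)).Nonempty := htight.mono fun p hp => hp.1
  rw [setDim, setDim, if_pos htight, if_pos hAne, hT, hA, ← hdim]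
  push_cast
  ring

theorem affine_add_single (x : Fin η → ℝ) (δ : ℝ) (i : Fin η) :
    affine w b (x + δ • Pi.single i 1) = affine w b x + w i * δ := by
  simp only [affine, Pi.add_apply, Pi.smul_apply, smul_eq_mul, mul_add, Finset.sum_add_distrib,
    Pi.single_apply, mul_ite, mul_one, mul_zero, Finset.sum_ite_eq', Finset.mem_univ, if_true]
  ring

/-- Inside the box, one can move along a nondegenerate coordinate without changing the (strict)
sign `σ` of the affine function. -/
theorem exists_move {x : Fin η → ℝ} (hx : x ∈ Set.Icc L U) {σ : ℝ}
    (hσ : 0 < σ * affine w b x) {i : Fin η} (hi : L i ≠ U i) :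
    ∃ δ : ℝ, δ ≠ 0 ∧ x + δ • Pi.single i 1 ∈ Set.Icc L U ∧
      0 ≤ σ * affine w b (x + δ • Pi.single i 1) := by
  obtain ⟨v, hv, hvx⟩ : ∃ v ∈ Set.Icc (L i) (U i), v - x i ≠ 0 := by
    have := (hx.1 i).trans (hx.2 i)
    by_cases hl : L i = x i
    · exact ⟨U i, ⟨this, le_rfl⟩, sub_ne_zero.2 fun h' => hi (hl.trans h'.symm)⟩
    · exact ⟨L i, ⟨le_rfl, this⟩, sub_ne_zero.2 hl⟩
  set M := σ * affine w b x
  set q := σ * (w i * (v - x i)) with hq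
  have hMq : 0 < M + |q| := by positivity
  -- A full step to `v` changes the signed value `M` by `q`. The fraction `t` solves `t * (M + |q|)
  -- = M`, so `M + t * q ≥ M - t * |q| = t * M ≥ 0`.
  have ht0 : 0 < M / (M + |q|) := by positivity
  have ht1 : M / (M + |q|) ≤ 1 := (div_le_one hMq).2 (by linarith [abs_nonneg q])
  set t := M / (M + |q|) with ht
  refine ⟨t * (v - x i), mul_ne_zero ht0.ne' hvx, ?_, ?_⟩
  · have key : t * v + (1 - t) * x i ∈ Set.Icc (L i) (U i) :=
      convex_Icc (L i) (U i) hv ⟨hx.1 i, hx.2 i⟩ ht0.le (by linarith) (by ring)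
    constructor <;> intro j <;> by_cases hj : j = i
    · subst hj; simp; linarith [key.1]
    · simpa [hj] using hx.1 j
    · subst hj; simp; linarith [key.2]
    · simpa [hj] using hx.2 j
  · rw [affine_add_single]
    have e : σ * (affine w b x + w i * (t * (v - x i))) = M + t * q := by rw [hq]; ring
    have e' : t * (M + |q|) = M := by rw [ht]; field_simp
    have : 0 ≤ t * M := by positivity
    rw [e]
    nlinarith [mul_le_mul_of_nonneg_left (neg_abs_le q) ht0.le]

/-- Serves both levels: `β = 1` at `z = 1` and `β = α` at `z = 0`. -/
theorem single_mem_vectorSpan {T : Set (Point η)} {x : Fin η → ℝ} {β z δ : ℝ} {i : Fin η}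
    (hδ : δ ≠ 0) (h1 : (x, β * affine w b x, z) ∈ T)
    (h2 : (x + δ • Pi.single i 1, β * affine w b (x + δ • Pi.single i 1), z) ∈ T) :
    (Pi.single i 1, β * w i, 0) ∈ vectorSpan ℝ T := by
  have := Submodule.smul_mem _ δ⁻¹ (vsub_mem_vectorSpan ℝ h2 h1)
  rw [affine_add_single] at this
  convert this using 1
  refine Prod.ext ?_ (Prod.ext ?_ ?_)
  · simp [hδ]
  · simp; field_simp; ring
  · simp

/-- Enough tight points of both integer levels make an inequality facet-defining: over `z = 1`
those that agree with a point `u` outside of `J`, and over `z = 0` those that agree with a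
point `l` in `J`. -/
theorem inf_ker_le_of_faces {c : LinIneq η} (hc : c.cy ≠ 0) {J : Finset (Fin η)}
    {l u l' u' : Fin η → ℝ} {y y' : ℝ} (hl : l ∈ Set.Icc L U) (hu : u ∈ Set.Icc L U)
    (hl' : l' ∈ Set.Icc L U) (hu' : u' ∈ Set.Icc L U)
    (hfu : J.Nonempty → 0 < affine w b u) (hfl : Jᶜ.Nonempty → affine w b l < 0)
    (hone : J.Nonempty → ∀ x ∈ Set.Icc L U, (∀ i ∉ J, x i = u i) → 0 ≤ affine w b x →
      (x, affine w b x, 1) ∈ tightPoints α w b L U c)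
    (hzero : Jᶜ.Nonempty → ∀ x ∈ Set.Icc L U, (∀ i ∈ J, x i = l i) → affine w b x ≤ 0 →
      (x, α * affine w b x, 0) ∈ tightPoints α w b L U c)
    (h1 : (u', y', 1) ∈ tightPoints α w b L U c) (h0 : (l', y, 0) ∈ tightPoints α w b L U c) :
    boxDirection L U ⊓ LinearMap.ker c.linear ≤ vectorSpan ℝ (tightPoints α w b L U c) := by
  refine inf_ker_le_vectorSpan hc (fun i => (if i ∈ J then 1 else α) * w i)
    (vsub_mem_vectorSpan ℝ h1 h0) (by simp) ?_ ?_
  · intro i hi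
    have := hl'.1 i
    have := hl'.2 i
    have := hu'.1 i
    have := hu'.2 i
    change u' i - l' i = 0
    linarith
  · intro i hi
    by_cases hJ : i ∈ J
    · have hne : J.Nonempty := ⟨i, hJ⟩
      obtain ⟨δ, hδ, hmem, hpos⟩ := exists_move hu (σ := 1) (by simpa using hfu hne) hi
      rw [one_mul] at hpos
      simp only [if_pos hJ]
      refine single_mem_vectorSpan (b := b) (x := u) (z := 1) hδ ?_ ?_
      · rw [one_mul]; exact hone hne u hu (fun _ _ => rfl) (hfu hne).le
      · rw [one_mul]
        refine hone hne _ hmem (fun j hj => ?_) hpos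
        simp [show j ≠ i from fun e => hj (e ▸ hJ)]
    · have hne : Jᶜ.Nonempty := ⟨i, Finset.mem_compl.2 hJ⟩
      obtain ⟨δ, hδ, hmem, hpos⟩ := exists_move hl (σ := -1) (by simpa using hfl hne) hi
      simp only [if_neg hJ]
      refine single_mem_vectorSpan (b := b) (x := l) (z := 0) hδ ?_ ?_
      · exact hzero hne l hl (fun _ _ => rfl) (hfl hne).le
      · refine hzero hne _ hmem (fun j hj => ?_) (by linarith)
        simp [show j ≠ i from fun e => hJ (e ▸ hj)]

/-! ### Tight faces of the individual inequalities -/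

theorem lower1_violation (x : Fin η → ℝ) (y z : ℝ) :
    (lower1 w b).violation (x, y, z) = affine w b x - y := by
  simp only [LinIneq.violation, lower1, affine]
  ring

theorem lower2_violation (x : Fin η → ℝ) (y z : ℝ) :
    (lower2 α w b).violation (x, y, z) = α * affine w b x - y := by
  simp only [LinIneq.violation, lower2, affine, mul_assoc, ← Finset.mul_sum]
  ring

theorem exists_affine_eq_zero (h : L ≤ U) (hneg : affine w b (breveL w L U) < 0)
    (hpos : 0 < affine w b (breveU w L U)) : ∃ x ∈ Set.Icc L U, affine w b x = 0 := by
  have : (0 : ℝ) ∈ segment ℝ (affine w b (breveL w L U)) (affine w b (breveU w L U)) := by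
    rw [segment_eq_Icc (hneg.trans hpos).le]; exact ⟨hneg.le, hpos.le⟩
  obtain ⟨s, t, hs, ht, hst, e⟩ := this
  exact ⟨_, convex_Icc L U (breveL_mem h) (breveU_mem h) hs ht hst,
    by rw [affine_lineComb _ _ _ _ hst]; simpa using e⟩

theorem sign_of_irreducible (hα : α < 1)
    (hirr : IrreducibleNeuron ![affine w b, fun x => α * affine w b x] (Set.Icc L U)) :
    affine w b (breveL w L U) < 0 ∧ 0 < affine w b (breveU w L U) := by
  obtain ⟨x, hx, hx'⟩ := hirr 0
  obtain ⟨y, hy, hy'⟩ := hirr 1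
  have h1 : α * affine w b x < affine w b x := hx' 1 (by decide)
  have h2 : affine w b y < α * affine w b y := hy' 0 (by decide)
  have h3 : affine w b y < 0 := by nlinarith
  have h4 : 0 < affine w b x := by nlinarith
  exact ⟨(affine_breveL_le hy).trans_lt h3, h4.trans_le (affine_le_breveU hx)⟩

theorem point_one_mem (hα : α < 1) (h : L ≤ U) {x : Fin η → ℝ} (hx : x ∈ Set.Icc L U)
    (hf : 0 ≤ affine w b x) : (x, affine w b x, 1) ∈ integerPoints (bigM α w b L U) :=
  (mem_integerPoints_bigM hα h).2 ⟨hx, Or.inr ⟨rfl, rfl, hf⟩⟩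

theorem point_zero_mem (hα : α < 1) (h : L ≤ U) {x : Fin η → ℝ} (hx : x ∈ Set.Icc L U)
    (hf : affine w b x ≤ 0) : (x, α * affine w b x, 0) ∈ integerPoints (bigM α w b L U) :=
  (mem_integerPoints_bigM hα h).2 ⟨hx, Or.inl ⟨rfl, rfl, hf⟩⟩

/-- Tight on the whole level `z = 1`, hence `J = Finset.univ`; at `z = 0` tightness means `f x = 0`,
so a zero of `f` supplies the point there. For `lower2` the levels swap roles. -/
theorem tightPoints_lower1_span (hα : α < 1) (h : L ≤ U)
    (hneg : affine w b (breveL w L U) < 0) (hpos : 0 < affine w b (breveU w L U)) :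
    boxDirection L U ⊓ LinearMap.ker (lower1 w b).linear ≤
      vectorSpan ℝ (tightPoints α w b L U (lower1 w b)) := by
  obtain ⟨x, hx, hfx⟩ := exists_affine_eq_zero h hneg hpos
  have hone : ∀ x ∈ Set.Icc L U, 0 ≤ affine w b x →
      (x, affine w b x, 1) ∈ tightPoints α w b L U (lower1 w b) := fun x hx hf =>
    ⟨point_one_mem hα h hx hf, by rw [LinIneq.Tight, lower1_violation, sub_self]⟩
  refine inf_ker_le_of_faces (J := Finset.univ) (by simp [lower1]) hx (breveU_mem h)
    hx hx (fun _ => hpos) (by simp) (fun _ x hx _ => hone x hx) (by simp) (hone x hx hfx.ge)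
    (y := α * affine w b x) ⟨point_zero_mem hα h hx hfx.le, ?_⟩
  rw [LinIneq.Tight, lower1_violation, hfx]
  ring

theorem tightPoints_lower2_span (hα : α < 1) (h : L ≤ U)
    (hneg : affine w b (breveL w L U) < 0) (hpos : 0 < affine w b (breveU w L U)) :
    boxDirection L U ⊓ LinearMap.ker (lower2 α w b).linear ≤
      vectorSpan ℝ (tightPoints α w b L U (lower2 α w b)) := by
  obtain ⟨x, hx, hfx⟩ := exists_affine_eq_zero h hneg hpos
  have hzero : ∀ x ∈ Set.Icc L U, affine w b x ≤ 0 →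
      (x, α * affine w b x, 0) ∈ tightPoints α w b L U (lower2 α w b) := fun x hx hf =>
    ⟨point_zero_mem hα h hx hf, by rw [LinIneq.Tight, lower2_violation, sub_self]⟩
  refine inf_ker_le_of_faces (J := ∅) (by simp [lower2]) (breveL_mem h) hx
    hx hx (by simp) (fun _ => hneg) (by simp) (fun _ x hx _ => hzero x hx)
    (y' := affine w b x) ⟨point_one_mem hα h hx hfx.ge, ?_⟩ (hzero x hx hfx.le)
  rw [LinIneq.Tight, lower2_violation, hfx]
  ring

theorem cut_tight_one (hα : α < 1) (h : L ≤ U) {I : Finset (Fin η)} {x : Fin η → ℝ}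
    (hx : x ∈ Set.Icc L U) (hI : ∀ i ∉ I, x i = breveU w L U i) (hf : 0 ≤ affine w b x) :
    (x, affine w b x, 1) ∈ tightPoints α w b L U (cut α w b L U I) := by
  refine ⟨point_one_mem hα h hx hf, ?_⟩
  rw [LinIneq.Tight, cut_violation_one, sub_self, Finset.sum_eq_zero, mul_zero, sub_zero]
  intro i _
  split_ifs with hi
  · rfl
  · rw [hI i hi, sub_self]

theorem cut_tight_zero (hα : α < 1) (h : L ≤ U) {I : Finset (Fin η)} {x : Fin η → ℝ}
    (hx : x ∈ Set.Icc L U) (hI : ∀ i ∈ I, x i = breveL w L U i) (hf : affine w b x ≤ 0) :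
    (x, α * affine w b x, 0) ∈ tightPoints α w b L U (cut α w b L U I) := by
  refine ⟨point_zero_mem hα h hx hf, ?_⟩
  rw [LinIneq.Tight, cut_violation_zero, sub_self, Finset.sum_eq_zero, mul_zero, sub_zero]
  intro i _
  split_ifs with hi
  · rw [hI i hi, sub_self]
  · rfl

/-- Here `J = I`: coordinates in `I` move at `z = 1` from the corner `breveU`, the others at `z = 0`
from the corner `breveL`. -/
theorem tightPoints_cut_span (hα : α < 1) (h : L ≤ U)
    (hneg : affine w b (breveL w L U) < 0) (hpos : 0 < affine w b (breveU w L U))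
    (I : Finset (Fin η)) :
    boxDirection L U ⊓ LinearMap.ker (cut α w b L U I).linear ≤
      vectorSpan ℝ (tightPoints α w b L U (cut α w b L U I)) :=
  inf_ker_le_of_faces (by simp [cut]) (breveL_mem h) (breveU_mem h) (breveL_mem h)
    (breveU_mem h) (fun _ => hpos) (fun _ => hneg) (fun _ _ hx => cut_tight_one hα h hx)
    (fun _ _ hx => cut_tight_zero hα h hx)
    (cut_tight_one hα h (breveU_mem h) (fun _ _ => rfl) hpos.le)
    (cut_tight_zero hα h (breveL_mem h) (fun _ _ => rfl) hneg.le)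

/-- The tight points of `lower1` already span a hyperplane of `boxDirection`; one difference `d` of
integer points outside that kernel completes it. -/
theorem vectorSpan_integerPoints_eq (hα : α < 1) (h : L ≤ U)
    (hneg : affine w b (breveL w L U) < 0) (hpos : 0 < affine w b (breveU w L U)) :
    vectorSpan ℝ (integerPoints (bigM α w b L U)) = boxDirection L U := by
  have hle := vectorSpan_integerPoints_le (w := w) (b := b) hα h
  refine le_antisymm hle fun e he => ?_
  set d : Point η := (breveL w L U, α * affine w b (breveL w L U), 0) -
    (breveU w L U, affine w b (breveU w L U), 1) with hd
  have hdA : d ∈ vectorSpan ℝ (integerPoints (bigM α w b L U)) := vsub_mem_vectorSpan ℝ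
    (point_zero_mem hα h (breveL_mem h) hneg.le) (point_one_mem hα h (breveU_mem h) hpos.le)
  set f := (lower1 w b).linear
  have hfd : f d ≠ 0 := by
    have h1 := lower1_violation (w := w) (b := b) (breveL w L U)
      (α * affine w b (breveL w L U)) 0
    have h2 := lower1_violation (w := w) (b := b) (breveU w L U) (affine w b (breveU w L U)) 1
    rw [LinIneq.violation_eq] at h1 h2
    rw [hd, map_sub]
    have : (1 - α) * affine w b (breveL w L U) < 0 :=
      mul_neg_of_pos_of_neg (by linarith) hneg
    intro h0
    linarith
  have : e - (f e / f d) • d ∈ vectorSpan ℝ (integerPoints (bigM α w b L U)) := by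
    refine vectorSpan_mono ℝ (fun p hp => hp.1) (tightPoints_lower1_span hα h hneg hpos
      ⟨sub_mem he (Submodule.smul_mem _ _ (hle hdA)), ?_⟩)
    change f _ = 0
    rw [map_sub, map_smul, smul_eq_mul, div_mul_cancel₀ _ hfd, sub_self]
  simpa using add_mem this (Submodule.smul_mem _ (f e / f d) hdA)

theorem isFacetDefining (hα : α < 1) (h : L ≤ U)
    (hirr : IrreducibleNeuron ![affine w b, fun x => α * affine w b x] (Set.Icc L U))
    {c : LinIneq η} (hc : c ∈ bigMCore α w b L U ∪ cuts α w b L U) :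
    IsFacetDefining (bigM α w b L U) c := by
  obtain ⟨hneg, hpos⟩ := sign_of_irreducible hα hirr
  have hA := vectorSpan_integerPoints_eq hα h hneg hpos
  obtain ⟨x, hx, hfx⟩ := exists_affine_eq_zero h hneg hpos
  have hcut : ∀ I, IsFacetDefining (bigM α w b L U) (cut α w b L U I) := fun I =>
    isFacetDefining_of_inf_ker_le (by simp [cut]) hA (fun p hp => cut_holds_of_mem hα h I hp)
      ⟨_, cut_tight_one hα h (breveU_mem h) (fun _ _ => rfl) hpos.le⟩
      (tightPoints_cut_span hα h hneg hpos I)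
  rcases hc with hc | ⟨I, rfl⟩
  · have hval : IsValidIneq (bigM α w b L U) c := fun p hp => hp.1 c (Or.inl hc)
    rcases hc with rfl | rfl | rfl | rfl
    · exact isFacetDefining_of_inf_ker_le (by simp [lower1]) hA hval
        ⟨_, point_one_mem hα h hx hfx.ge, by rw [LinIneq.Tight, lower1_violation, sub_self]⟩
        (tightPoints_lower1_span hα h hneg hpos)
    · exact isFacetDefining_of_inf_ker_le (by simp [lower2]) hA hval
        ⟨_, point_zero_mem hα h hx hfx.le, by rw [LinIneq.Tight, lower2_violation, sub_self]⟩
        (tightPoints_lower2_span hα h hneg hpos)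
    · rw [upper1_eq_cut h]; exact hcut _
    · rw [upper2_eq_cut h]; exact hcut _
  · exact hcut I

theorem isFacetDefining_union_cuts_iff (hα : α < 1) (h : L ≤ U) (c : LinIneq η) :
    IsFacetDefining (bigM α w b L U ∪ cuts α w b L U) c ↔ IsFacetDefining (bigM α w b L U) c := by
  simp only [IsFacetDefining, IsValidIneq, integerPoints_union_cuts hα h]

/-! ### The separation routine -/

/-- A nonempty list of instructions as a program. -/
def block (i : Instr) : List Instr → Program
  | [] => .instr i
  | j :: l => .seq (.instr i) (block j l)

theorem runs_block (i : Instr) (l : List Instr) (σ : State) :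
    Runs (block i l) σ (l.length + 1) (l.foldl (fun τ j => j.apply τ) (i.apply σ)) := by
  induction l generalizing i σ with
  | nil => exact .instr i σ
  | cons j l ih =>
    rw [List.length_cons, add_comm (l.length + 1) 1]
    exact .seq (.instr i σ) (ih j (i.apply σ))

/-- Process the coordinate in index register `2`: put `w i * breveL i` and `w i * breveU i` into the
registers `18` and `19`, -/
def stepLoad : Program :=
  .seq (block (.load 14 0 2) [.load 15 1 2, .load 16 2 2, .load 17 3 2])
    (.ifLe 9 14 (block (.mul 18 14 15) [.mul 19 14 16]) (block (.mul 18 14 16) [.mul 19 14 15]))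

/-- decide whether `i` belongs to the set, update the sums in the registers `11` and `12`, -/
def stepSelect : Program :=
  .seq (block (.mul 20 14 17) [.mul 21 18 10, .sub 21 20 21, .mul 22 19 3])
    (.ifLe 21 22 (block (.add 11 11 18) [.sub 23 9 14])
      (block (.add 12 12 19) [.mul 23 0 14, .sub 23 9 23]))

/-- and store the coefficient. -/
def stepStore : Program := block (.store 4 2 23) [.mul 23 23 17, .add 13 13 23, .idxSucc 2]

/-- The loop body of the separation routine. -/
def stepProgram : Program := .seq stepLoad (.seq stepSelect stepStore)

/-- Compute the remaining coefficients and compare the violation with `0`. -/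
def finishProgram : Program :=
  .seq (block (.add 24 11 12) [.add 24 24 1, .sub 25 4 0, .mul 24 25 24, .sub 5 9 24,
      .add 6 1 11, .mul 6 0 6, .sub 6 6 11, .add 13 13 2, .mul 27 5 3, .add 13 13 27, .sub 13 13 6])
    (.ifLe 13 9 (.instr (.idxConst 1 0)) (.instr (.idxConst 1 1)))

/-- The separation routine for the exponential family. -/
def separationProgram : Program :=
  .seq (block (.const 4 1) [.sub 10 4 3])
    (.seq (.whileLt 2 0 stepProgram) finishProgram)

section Correctness

variable (α w b L U) (p : Point η)

/-- The values that the routine reads but does not change. -/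
structure InputKept (σ : State) : Prop where
  idx0 : σ.idx 0 = η
  reg0 : σ.reg 0 = α
  reg1 : σ.reg 1 = b
  reg2 : σ.reg 2 = p.2.1
  reg3 : σ.reg 3 = p.2.2
  reg4 : σ.reg 4 = 1
  reg9 : σ.reg 9 = 0
  reg10 : σ.reg 10 = 1 - p.2.2
  arr0 : σ.arr 0 = toArray w
  arr1 : σ.arr 1 = toArray L
  arr2 : σ.arr 2 = toArray U
  arr3 : σ.arr 3 = toArray p.1

/-- The loop invariant: the coordinates below `k` have been processed. -/
structure LoopInv (k : ℕ) (σ : State) : Prop extends InputKept α w b L U p σ where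
  idx2 : σ.idx 2 = k
  sumL : σ.reg 11 = ∑ n ∈ Finset.range k, toArray (fun i =>
    if i ∈ selected w L U p then w i * breveL w L U i else 0) n
  sumU : σ.reg 12 = ∑ n ∈ Finset.range k, toArray (fun i =>
    if i ∈ selected w L U p then 0 else w i * breveU w L U i) n
  sumX : σ.reg 13 = ∑ n ∈ Finset.range k, toArray (fun i =>
    (cut α w b L U (selected w L U p)).cx i * p.1 i) n
  coeff : ∀ i : Fin η, i < k → σ.arr 4 i = (cut α w b L U (selected w L U p)).cx i

variable {α w b L U p}

theorem stepProgram_runs {k : ℕ} (hk : k < η) {σ : State} (hσ : LoopInv α w b L U p k σ) :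
    ∃ t τ, Runs stepProgram σ t τ ∧ t ≤ 20 ∧ LoopInv α w b L U p (k + 1) τ := by
  obtain ⟨⟨i0, r0, r1, r2, r3, r4, r9, r10, a0, a1, a2, a3⟩, i2, sL, sU, sX, co⟩ := hσ
  set j : Fin η := ⟨k, hk⟩ with hj
  have tA : ∀ v : Fin η → ℝ, toArray v k = v j := fun v => by simp [toArray, hk, hj]
  -- loading
  obtain ⟨t₁, σ₁, hr₁, ht₁, hreg, e14, e17, e18, e19, hidx, harr⟩ : ∃ t σ₁, Runs stepLoad σ t σ₁ ∧
      t ≤ 7 ∧ (∀ n < 14, σ₁.reg n = σ.reg n) ∧ σ₁.reg 14 = w j ∧ σ₁.reg 17 = p.1 j ∧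
      σ₁.reg 18 = w j * breveL w L U j ∧ σ₁.reg 19 = w j * breveU w L U j ∧ σ₁.idx = σ.idx ∧
      σ₁.arr = σ.arr := by
    by_cases hw : 0 ≤ w j
    · refine ⟨_, _, .seq (runs_block _ _ _) (.ifTrue ?_ (runs_block _ _ _)), by simp, ?_⟩
      · simpa [Instr.apply, r9, a0, i2, tA] using hw
      · refine ⟨fun n hn => ?_, ?_⟩
        · simp [Instr.apply, Function.update, show n ≠ 14 by omega, show n ≠ 15 by omega,
            show n ≠ 16 by omega, show n ≠ 17 by omega, show n ≠ 18 by omega,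
            show n ≠ 19 by omega]
        · simp [Instr.apply, a0, a1, a2, a3, i2, tA, breveL, breveU, hw]
    · refine ⟨_, _, .seq (runs_block _ _ _) (.ifFalse ?_ (runs_block _ _ _)), by simp, ?_⟩
      · simpa [Instr.apply, r9, a0, i2, tA] using hw
      · refine ⟨fun n hn => ?_, ?_⟩
        · simp [Instr.apply, Function.update, show n ≠ 14 by omega, show n ≠ 15 by omega,
            show n ≠ 16 by omega, show n ≠ 17 by omega, show n ≠ 18 by omega,
            show n ≠ 19 by omega]
        · simp [Instr.apply, a0, a1, a2, a3, i2, tA, breveL, breveU, hw]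
  -- selecting
  obtain ⟨t₂, σ₂, hr₂, ht₂, hreg₂, s11, s12, s13, s17, s23, hidx₂, harr₂⟩ : ∃ t σ₂,
      Runs stepSelect σ₁ t σ₂ ∧ t ≤ 8 ∧ (∀ n < 11, σ₂.reg n = σ₁.reg n) ∧
      σ₂.reg 11 = σ₁.reg 11 + (if j ∈ selected w L U p then w j * breveL w L U j else 0) ∧
      σ₂.reg 12 = σ₁.reg 12 + (if j ∈ selected w L U p then 0 else w j * breveU w L U j) ∧
      σ₂.reg 13 = σ₁.reg 13 ∧ σ₂.reg 17 = σ₁.reg 17 ∧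
      σ₂.reg 23 = (cut α w b L U (selected w L U p)).cx j ∧ σ₂.idx = σ₁.idx ∧
      σ₂.arr = σ₁.arr := by
    have g0 := (hreg 0 (by norm_num)).trans r0
    have g3 := (hreg 3 (by norm_num)).trans r3
    have g9 := (hreg 9 (by norm_num)).trans r9
    have g10 := (hreg 10 (by norm_num)).trans r10
    -- The registers `21` and `22` hold the two sides of the inequality that defines `selected`.
    by_cases hs : j ∈ selected w L U p
    · refine ⟨_, _, .seq (runs_block _ _ _) (.ifTrue ?_ (runs_block _ _ _)), by simp, ?_⟩
      · simpa [Instr.apply, g3, g10, e14, e17, e18, e19, mem_selected, mul_sub, mul_assoc] using hs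
      · refine ⟨fun n hn => ?_, ?_⟩
        · simp [Instr.apply, Function.update, show n ≠ 11 by omega, show n ≠ 20 by omega,
            show n ≠ 21 by omega, show n ≠ 22 by omega, show n ≠ 23 by omega]
        · simp [Instr.apply, g9, e14, e18, cut, hs]
    · refine ⟨_, _, .seq (runs_block _ _ _) (.ifFalse ?_ (runs_block _ _ _)), by simp, ?_⟩
      · simpa [Instr.apply, g3, g10, e14, e17, e18, e19, mem_selected, mul_sub, mul_assoc] using hs
      · refine ⟨fun n hn => ?_, ?_⟩
        · simp [Instr.apply, Function.update, show n ≠ 12 by omega, show n ≠ 20 by omega,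
            show n ≠ 21 by omega, show n ≠ 22 by omega, show n ≠ 23 by omega]
        · simp [Instr.apply, g0, g9, e14, e19, cut, hs]
  refine ⟨_, _, .seq hr₁ (.seq hr₂ (runs_block _ _ _)), ?_, ?_⟩
  -- At most 7 steps for loading, 8 for selecting and 4 for storing.
  · simp only [List.length_cons, List.length_nil]; omega
  have hreg' : ∀ n < 11, σ₂.reg n = σ.reg n := fun n hn =>
    (hreg₂ n hn).trans (hreg n (by omega))
  have hidx' := hidx₂.trans hidx
  have harr' := harr₂.trans harr
  constructor
  · constructor <;> simp [Instr.apply, *]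
  · simp [Instr.apply, hidx', i2]
  · simp [Instr.apply, Finset.sum_range_succ, tA, s11, hreg, sL]
  · simp [Instr.apply, Finset.sum_range_succ, tA, s12, hreg, sU]
  · simp [Instr.apply, Finset.sum_range_succ, tA, s13, s17, e17, s23, hreg, sX]
  · intro i hi
    rcases (Nat.lt_succ_iff.1 hi).eq_or_lt with hik | hik
    · obtain rfl : i = j := Fin.ext hik
      simp [Instr.apply, hidx', i2, hj, s23]
    · simp [Instr.apply, hidx', harr', i2, hik.ne, co i hik]

theorem loop_runs (m : ℕ) {k : ℕ} (hk : k + m = η) {σ : State} (hσ : LoopInv α w b L U p k σ) :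
    ∃ t τ, Runs (.whileLt 2 0 stepProgram) σ t τ ∧ t ≤ 21 * m + 1 ∧ LoopInv α w b L U p η τ := by
  induction m generalizing k σ with
  | zero =>
    obtain rfl : k = η := hk
    exact ⟨1, σ, .whileDone (by rw [hσ.idx2, hσ.idx0]; exact lt_irrefl _), le_rfl, hσ⟩
  | succ m ih =>
    obtain ⟨t, τ, hr, ht, hτ⟩ := stepProgram_runs (by omega) hσ
    obtain ⟨u, υ, hr', hu, hυ⟩ := ih (by omega) hτ
    exact ⟨_, υ, .whileStep (by rw [hσ.idx2, hσ.idx0]; omega) hr hr', by omega, hυ⟩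

/-- Turns the partial sums of the invariant, padded with zeros through `toArray`, into the sums that
occur in the cut. -/
theorem sum_range_toArray (v : Fin η → ℝ) : ∑ n ∈ Finset.range η, toArray v n = ∑ i, v i := by
  rw [Finset.sum_range]
  exact Finset.sum_congr rfl fun i _ => by simp [toArray]

theorem finishProgram_runs {σ : State} (hσ : LoopInv α w b L U p η σ) :
    ∃ t τ, Runs finishProgram σ t τ ∧ t ≤ 14 ∧
      output η τ = (open Classical in
        if (cut α w b L U (selected w L U p)).Holds p then none
        else some (cut α w b L U (selected w L U p))) := by
  obtain ⟨⟨i0, r0, r1, r2, r3, r4, r9, r10, a0, a1, a2, a3⟩, i2, sL, sU, sX, co⟩ := hσ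
  rw [sum_range_toArray] at sL sU sX
  set c := cut α w b L U (selected w L U p) with hc
  have e1 : ∑ i ∈ selected w L U p, w i * breveL w L U i = σ.reg 11 := by
    rw [sL]; simp
  have e2 : ∑ i ∈ (selected w L U p)ᶜ, w i * breveU w L U i = σ.reg 12 := by
    rw [sU, sum_compl_eq_sum_ite]
  -- Written with `0 -` because the program negates by subtracting from register `9`.
  have ecz : c.cz = 0 - (1 - α) * (σ.reg 11 + σ.reg 12 + b) := by
    rw [hc, cut, e1, e2]; ring
  have erhs : c.rhs = α * (b + σ.reg 11) - σ.reg 11 := by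
    rw [hc, cut, e1]
  have ecy : c.cy = 1 := rfl
  have ev : c.violation p = σ.reg 13 + p.2.1 + c.cz * p.2.2 - c.rhs := by
    rw [LinIneq.violation, sX, ecy, one_mul]
  have hcoeff : (fun i : Fin η => σ.arr 4 i) = c.cx := funext fun i => co i i.2
  by_cases hv : c.Holds p
  · refine ⟨_, _, .seq (runs_block _ _ _) (.ifTrue ?_ (.instr _ _)), by simp, ?_⟩
    · rw [LinIneq.Holds, ev, ecz, erhs] at hv
      simpa [Instr.apply, r0, r1, r2, r3, r4, r9] using hv
    · simp [output, hv, Instr.apply]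
  · refine ⟨_, _, .seq (runs_block _ _ _) (.ifFalse ?_ (.instr _ _)), by simp, ?_⟩
    · rw [LinIneq.Holds, ev, ecz, erhs] at hv
      simpa [Instr.apply, r0, r1, r2, r3, r4, r9] using hv
    · rw [if_neg hv]
      simp [output, Instr.apply, r0, r1, r4, r9, hcoeff, ← ecy, ← erhs]
      rw [← zero_sub (_ * _), ecy, ← ecz]
      rfl

theorem separationProgram_runs (hα : α < 1) :
    ∃ t τ, Runs separationProgram (inputState α w b L U p) t τ ∧ t ≤ 50 * (η + 1) ∧
      IsSeparationAnswer (cuts α w b L U) p (output η τ) := by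
  have hinit := runs_block (.const 4 1) [.sub 10 4 3] (inputState α w b L U p)
  set σ := [Instr.sub 10 4 3].foldl (fun τ j => j.apply τ)
    ((Instr.const 4 1).apply (inputState α w b L U p)) with hσ
  -- The zero in register `9`, the empty sums and the initial loop counter are the default values of
  -- the memory.
  have hinv : LoopInv α w b L U p 0 σ := by
    constructor
    · constructor <;> simp [hσ, Instr.apply, inputState]
    all_goals simp [hσ, Instr.apply, inputState]
  obtain ⟨t, τ, hr, ht, hτ⟩ := loop_runs η (zero_add η) hinv
  obtain ⟨u, υ, hr', hu, hυ⟩ := finishProgram_runs hτ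
  -- The total is at most `2 + (21 * η + 1) + 14`.
  refine ⟨_, υ, .seq hinit (.seq hr hr'), by simp only [List.length_cons, List.length_nil]; omega, ?_⟩
  rw [hυ]
  split_ifs with hc
  · rintro _ ⟨I, rfl⟩
    exact (cut_violation_le_selected hα I p).trans hc
  · refine ⟨⟨_, rfl⟩, hc, ?_⟩
    rintro _ ⟨I, rfl⟩
    exact cut_violation_le_selected hα I p

end Correctness

end LeakyReLU

end

theorem proposition11 :
    (∀ (η : ℕ) (α : ℝ) (w : Fin η → ℝ) (b : ℝ) (L U : Fin η → ℝ),
      0 < α → α < 1 → L ≤ U →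
        IsFormulation (bigM α w b L U)
          (graph (leaky α ∘ affine w b) (Set.Icc L U)) ∧
        IsIdealFormulation (bigM α w b L U ∪ cuts α w b L U)
          (graph (leaky α ∘ affine w b) (Set.Icc L U)) ∧
        (IrreducibleNeuron ![affine w b, fun x => α * affine w b x] (Set.Icc L U) →
          ∀ c ∈ bigMCore α w b L U ∪ cuts α w b L U,
            IsFacetDefining (bigM α w b L U) c ∧
            IsFacetDefining (bigM α w b L U ∪ cuts α w b L U) c)) ∧
    (∃ (P : Program) (C : ℕ),
      ∀ (η : ℕ) (α : ℝ) (w : Fin η → ℝ) (b : ℝ) (L U : Fin η → ℝ),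
        0 < α → α < 1 → L ≤ U → ∀ p : Point η,
          ∃ (t : ℕ) (τ : State),
            Runs P (inputState α w b L U p) t τ ∧ t ≤ C * (η + 1) ∧
            IsSeparationAnswer (cuts α w b L U) p (output η τ)) := by
  refine ⟨fun η α w b L U _ hα h => ⟨isFormulation_bigM hα h, isIdealFormulation_union_cuts hα h,
    fun hirr c hc => ?_⟩, separationProgram, 50, fun η α w b L U _ hα _ p =>
      separationProgram_runs hα⟩
  have hf := isFacetDefining hα h hirr hc
  exact ⟨hf, (isFacetDefining_union_cuts_iff hα h c).2 hf⟩
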